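/- **Setting.** Fix a set $\mathbf{dom}$ of constants that includes $\mathbb{Q}_{\ge 0}$, and relation names, each with a signature $(n,k,J)$: arity $n$, primary key formed by positions $1,\dots,k$, and a set $J$ of numerical positions. Some of the variables are numerical; valuations map numerical variables to $\mathbb{Q}_{\ge 0}$. An atom $R(u_1,\dots,u_n)$ has a variable or constant at each position, and a numerical variable or a number in $\mathbb{Q}_{\ge 0}$ at each numerical position; a fact is an atom without variables. A database instance is a finite set of facts; it is consistent if it contains no two distinct facts of the same relation that agree on the primary key. A repair of a database instance is a $\subseteq$-maximal consistent subset of it. **Queries.** Let $g()\coloneqq\mathtt{MIN}(r)\leftarrow q(\vec y)$, where $q(\vec y)$ is a conjunction of atoms with pairwise distinct relation names, $\vec y$ consists of all its variables, and $r$ is either a numerical variable in $\vec y$ or a constant in $\mathbb{Q}_{\ge 0}$. The value of $g()$ on a database instance is the minimum of the multiset of all numbers $\theta(r)$, where $\theta$ ranges over the valuations of $\vec y$ that map all atoms of $q$ to facts of the instance (on the empty multiset the value is an arbitrary fixed constant $f_0$). The body is *certain* in $\mathbf{db}$ if every repair of $\mathbf{db}$ satisfies $\exists\vec y\,q(\vec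 y)$. $\mathrm{GLB\text{-}CQA}(g())$ is the function that maps a database instance $\mathbf{db}$ to $\bot$ if the body is not certain in $\mathbf{db}$, and otherwise to the minimum, over all repairs $\mathbf r$ of $\mathbf{db}$, of the value of $g()$ on $\mathbf r$. **Attack graph.** For an atom $F$, let $\mathrm{vars}(F)$ be its set of variables and $\mathrm{key}(F)$ the set of those that occur at a primary-key position. Let $F^{+}$ be the set of variables $x$ of $q$ such that the functional dependency $\mathrm{key}(F)\to x$ is logically implied by $\{\mathrm{key}(G)\to\mathrm{vars}(G)\mid G\in q,\ G\neq F\}$. The atom $F$ attacks a variable $x$ if there is a sequence $x_1,\dots,x_m=x$ of variables outside $F^{+}$ with $x_1\in\mathrm{vars}(F)\setminus\mathrm{key}(F)$ such that any two adjacent ones occur together in some atom of $q$. The attack graph has the atoms of $q$ as vertices and an edge from $F$ to $G\neq F$ if $F$ attacks some variable of $G$. **Logic.** First-order logic with aggregation is predicate calculus with equality, with quantifiers ranging over $\mathbf{dom}$ (over $\mathbb{Q}_{\ge 0}$ for numerical variables), extended with numerical terms that may be compared by equality: numbers in $\mathbb{Q}_{\ge 0}$, numerical variables, and $\mathrm{Aggr}_{\mathcal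 F}\,\vec z\,[s,\varphi]$, for $\varphi$ a formula, $\vec z$ some of its free variables, $s$ a number in $\mathbb{Q}_{\ge 0}$ or a numerical variable free in $\varphi$, and $\mathcal F$ any aggregate operator, that is, a function that maps nonempty finite multisets over $\mathbb{Q}_{\ge 0}$ to $\mathbb{Q}_{\ge 0}$ and the empty multiset to some constant, possibly $\bot$. Such a term binds $\vec z$, and its value is $\mathcal F$ of the multiset of values of $s$ over all valuations of $\vec z$ that satisfy $\varphi$; it is required that there are finitely many of these on every database instance. A numerical query of the logic is a numerical term without free variables. **Theorem.** Let $g()\coloneqq\mathtt{MIN}(r)\leftarrow q(\vec y)$ be a query as above such that the attack graph of $\exists\vec y\,q(\vec y)$ is acyclic. Then $\mathrm{GLB\text{-}CQA}(g())$ is expressible in first-order logic with aggregation: there is a numerical query $t$ of that logic whose value on every database instance $\mathbf{db}$ is $\mathrm{GLB\text{-}CQA}(g())$ on $\mathbf{db}$. Moreover, for every database instance $\mathbf{db}$, the value of $\mathrm{GLB\text{-}CQA}(g())$ on $\mathbf{db}$ is the value of $g()$ on $\mathbf{db}$ itself if the body is certain in $\mathbf{db}$, and $\bot$ otherwise. 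-/

import Mathlib

/-! ## Relational schemas, variables, atoms, facts, databases -/

/-- The fixed relational setting: the set `Dom` of constants, which includes the non-negative
rationals (through `num`), and the relation names with their signatures `(n, k, J)`:
arity `n`, primary key formed by the first `k` positions, numerical positions `J`. -/
structure Schema where
  Dom : Type
  num : NNRat ↪ Dom
  Rel : Type
  arity : Rel → ℕ
  keyLen : Rel → ℕ
  keyLen_le : ∀ R, keyLen R ≤ arity R
  numeric : ∀ R, Set (Fin (arity R))

/-- Variables; the variables `num n` are the numerical ones. -/
inductive Var where
  | obj (n : ℕ)
  | num (n : ℕ)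
  deriving DecidableEq

/-- Primitive numerical terms: numerical variables and non-negative rational numbers. -/
inductive NumPrim where
  | var (n : ℕ)
  | const (c : NNRat)

/-- A variable or a constant. -/
inductive Term (S : Schema) where
  | var (x : Var)
  | const (c : S.Dom)

def NumPrim.toTerm (S : Schema) : NumPrim → Term S
  | .var n => .var (.num n)
  | .const c => .const (S.num c)

def NumPrim.vars : NumPrim → Finset Var
  | .var n => {Var.num n}
  | .const _ => ∅

def Term.vars {S : Schema} : Term S → Finset Var
  | .var x => {x}
  | .const _ => ∅

/-- An atom `R(u₁, …, uₙ)`; numerical positions hold numerical variables or numbers. -/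
structure Atom (S : Schema) where
  rel : S.Rel
  args : Fin (S.arity rel) → Term S
  numeric_args : ∀ j ∈ S.numeric rel, ∃ p : NumPrim, args j = p.toTerm S

namespace Atom

variable {S : Schema}

def vars (F : Atom S) : Finset Var :=
  Finset.univ.biUnion fun i => (F.args i).vars

/-- The variables that occur at a position of the primary key. -/
def keyVars (F : Atom S) : Finset Var :=
  (Finset.univ.filter fun i : Fin (S.arity F.rel) => i.val < S.keyLen F.rel).biUnion
    fun i => (F.args i).vars

def notKeyVars (F : Atom S) : Finset Var := F.vars \ F.keyVars

end Atom

/-- A fact: an atom without variables. -/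
structure DbFact (S : Schema) where
  rel : S.Rel
  args : Fin (S.arity rel) → S.Dom
  numeric_args : ∀ j ∈ S.numeric rel, args j ∈ Set.range S.num

/-- Same relation name and same primary-key values. -/
def DbFact.KeyEqual {S : Schema} (A B : DbFact S) : Prop :=
  ∃ h : A.rel = B.rel, ∀ i : Fin (S.arity A.rel), i.val < S.keyLen A.rel →
    A.args i = B.args (Fin.cast (congrArg S.arity h) i)

/-- A database instance: a finite set of facts, possibly violating the primary keys. -/
abbrev Database (S : Schema) := Finset (DbFact S)

namespace Database

variable {S : Schema}

def Consistent (db : Database S) : Prop :=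
  ∀ A ∈ db, ∀ B ∈ db, A.KeyEqual B → A = B

/-- A repair of `db`: an inclusion-maximal consistent subset of `db`. -/
def IsRepair (db r : Database S) : Prop :=
  Maximal (fun s : Database S => s ⊆ db ∧ s.Consistent) r

end Database

/-! ## Valuations -/

/-- A total valuation of the variables; numerical variables take values in the non-negative
rationals.  A valuation over a set `U` of variables is represented by any total valuation that
coincides with it on `U`. -/
structure VarValuation (S : Schema) where
  onObj : ℕ → S.Dom
  onNum : ℕ → NNRat

namespace VarValuation

variable {S : Schema}

def get (θ : VarValuation S) : Var → S.Dom
  | .obj n => θ.onObj n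
  | .num n => S.num (θ.onNum n)

def termVal (θ : VarValuation S) : Term S → S.Dom
  | .var x => θ.get x
  | .const c => c

def primVal (θ : VarValuation S) : NumPrim → NNRat
  | .var n => θ.onNum n
  | .const c => c

theorem termVal_toTerm (θ : VarValuation S) (p : NumPrim) :
    θ.termVal (p.toTerm S) = S.num (θ.primVal p) := by
  cases p <;> rfl

/-- The fact `θ(F)`. -/
def ground (θ : VarValuation S) (F : Atom S) : DbFact S where
  rel := F.rel
  args := fun i => θ.termVal (F.args i)
  numeric_args := by
    intro j hj
    obtain ⟨p, hp⟩ := F.numeric_args j hj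
    exact ⟨θ.primVal p, by rw [hp, termVal_toTerm]⟩

/-- `τ` coincides with `θ` on every variable outside `ys`. -/
def AgreeOff (ys : Finset Var) (θ τ : VarValuation S) : Prop :=
  ∀ x, x ∉ ys → τ.get x = θ.get x

/-- A fixed valuation, used to evaluate expressions without free variables. -/
def zero (S : Schema) : VarValuation S where
  onObj := fun _ => S.num 0
  onNum := fun _ => 0

end VarValuation

/-! ## Aggregate operators -/

/-- A (positive) aggregate operator: a function from finite multisets of non-negative rationals
that is non-negative rational on nonempty multisets and takes an arbitrary constant value on the
empty one.  The value `none` stands for the distinguished non-numerical constant `⊥`. -/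
structure AggOp where
  onEmpty : Option NNRat
  onNonempty : (X : Multiset NNRat) → X ≠ 0 → NNRat

def AggOp.apply (F : AggOp) (X : Multiset NNRat) : Option NNRat :=
  if h : X = 0 then F.onEmpty else some (F.onNonempty X h)

/-- The minimum, with the convention that its value on the empty multiset is `f₀`. -/
def AggOp.min (f₀ : Option NNRat) : AggOp where
  onEmpty := f₀
  onNonempty := fun X h => X.toFinset.min' (by simpa using h)

/-! ## First-order logic with aggregation -/

mutual

/-- Numerical terms: primitive ones, and `Aggr_F ys [r, φ]`, which binds the variables `ys`. -/
inductive NumTerm (S : Schema) where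
  | prim (p : NumPrim)
  | agg (F : AggOp) (ys : Finset Var) (r : NumPrim) (φ : Formula S)

/-- Formulas: predicate calculus with equality over the relation names and the constants,
extended by equalities between numerical terms. -/
inductive Formula (S : Schema) where
  | verum
  | atom (F : Atom S)
  | eq (s t : Term S)
  | numEq (s t : NumTerm S)
  | neg (φ : Formula S)
  | and (φ ψ : Formula S)
  | ex (x : Var) (φ : Formula S)

end

mutual

/-- Free variables of a numerical term. -/
def NumTerm.freeVars {S : Schema} : NumTerm S → Finset Var
  | .prim p => p.vars
  | .agg _ ys r φ => (r.vars ∪ φ.freeVars) \ ys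

/-- Free variables of a formula. -/
def Formula.freeVars {S : Schema} : Formula S → Finset Var
  | .verum => ∅
  | .atom F => F.vars
  | .eq s t => s.vars ∪ t.vars
  | .numEq s t => s.freeVars ∪ t.freeVars
  | .neg φ => φ.freeVars
  | .and φ ψ => φ.freeVars ∪ ψ.freeVars
  | .ex x φ => φ.freeVars \ {x}

end

open Classical in
/-- `F` applied to the multiset of the numbers `θ(r)`, where `θ` ranges over the finite set `Θ`
of valuations.  The value for infinite `Θ` is immaterial: see `NumTerm.WellFormed`. -/
noncomputable def AggOp.over {S : Schema} (F : AggOp) (Θ : Set (VarValuation S)) (r : NumPrim) :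
    Option NNRat :=
  if h : Θ.Finite then F.apply (h.toFinset.val.map fun θ => θ.primVal r) else F.onEmpty

mutual

/-- The value of a numerical term on `db`, under a valuation of its free variables. -/
noncomputable def NumTerm.eval {S : Schema} (db : Database S) :
    NumTerm S → VarValuation S → Option NNRat
  | .prim p, θ => some (θ.primVal p)
  | .agg F ys r φ, θ => F.over {τ | θ.AgreeOff ys τ ∧ φ.Holds db τ} r

/-- Satisfaction of a formula in `db`; variables range over all constants, numerical variables
over all non-negative rationals. -/
noncomputable def Formula.Holds {S : Schema} (db : Database S) : Formula S → VarValuation S → Prop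
  | .verum, _ => True
  | .atom F, θ => θ.ground F ∈ db
  | .eq s t, θ => θ.termVal s = θ.termVal t
  | .numEq s t, θ => s.eval db θ = t.eval db θ
  | .neg φ, θ => ¬ φ.Holds db θ
  | .and φ ψ, θ => φ.Holds db θ ∧ ψ.Holds db θ
  | .ex x φ, θ => ∃ τ, θ.AgreeOff {x} τ ∧ φ.Holds db τ

end

mutual

/-- In every aggregation `Aggr_F ys [r, φ]`, the variables `ys` and the variable of `r` are free
in `φ`, and the aggregated multiset is finite on every database instance. -/
def NumTerm.WellFormed {S : Schema} : NumTerm S → Prop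
  | .prim _ => True
  | .agg _ ys r φ => ys ⊆ φ.freeVars ∧ r.vars ⊆ φ.freeVars ∧ φ.WellFormed ∧
      ∀ (db : Database S) (θ : VarValuation S), {τ | θ.AgreeOff ys τ ∧ φ.Holds db τ}.Finite

/-- All aggregations inside the formula are well-formed. -/
def Formula.WellFormed {S : Schema} : Formula S → Prop
  | .verum => True
  | .atom _ => True
  | .eq _ _ => True
  | .numEq s t => s.WellFormed ∧ t.WellFormed
  | .neg φ => φ.WellFormed
  | .and φ ψ => φ.WellFormed ∧ ψ.WellFormed
  | .ex _ φ => φ.WellFormed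

end

/-- A numerical query of first-order logic with aggregation: a well-formed numerical term without
free variables. -/
def NumTerm.IsNumQuery {S : Schema} (t : NumTerm S) : Prop :=
  t.WellFormed ∧ t.freeVars = ∅

/-- The value of a numerical query on `db` (there are no free variables, so that the valuation
plays no role). -/
noncomputable def NumTerm.value {S : Schema} (t : NumTerm S) (db : Database S) : Option NNRat :=
  t.eval db (VarValuation.zero S)

/-! ## Conjunctive queries and attack graphs -/

/-- A conjunction of atoms, given by the list of its atoms. -/
abbrev CQ (S : Schema) := List (Atom S)

namespace CQ

variable {S : Schema}

def vars (q : CQ S) : Finset Var := q.foldr (fun F U => F.vars ∪ U) ∅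

/-- The conjunction as a formula. -/
def body (q : CQ S) : Formula S := q.foldr (fun F φ => .and (.atom F) φ) .verum

/-- No relation name occurs in two atoms. -/
def SelfJoinFree (q : CQ S) : Prop := (q.map Atom.rel).Nodup

/-- `db` satisfies the Boolean query obtained by quantifying all variables existentially. -/
def SatisfiedIn (q : CQ S) (db : Database S) : Prop :=
  ∃ θ : VarValuation S, ∀ F ∈ q, θ.ground F ∈ db

/-- Every repair of `db` satisfies the Boolean query. -/
def CertainIn (q : CQ S) (db : Database S) : Prop :=
  ∀ r, db.IsRepair r → q.SatisfiedIn r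

end CQ

/-- A functional dependency `lhs → rhs` between sets of variables. -/
structure FD where
  lhs : Finset Var
  rhs : Finset Var

/-- The relation `M` (a set of tuples over the variables) satisfies the dependency. -/
def FD.HoldsIn (σ : FD) (M : Set (Var → ℕ)) : Prop :=
  ∀ s ∈ M, ∀ t ∈ M, (∀ x ∈ σ.lhs, s x = t x) → ∀ x ∈ σ.rhs, s x = t x

/-- Logical implication of functional dependencies. -/
def FD.Implies (K : Set FD) (σ : FD) : Prop :=
  ∀ M : Set (Var → ℕ), (∀ κ ∈ K, κ.HoldsIn M) → σ.HoldsIn M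

namespace CQ

variable {S : Schema}

/-- The functional dependencies `key(G) → vars(G)` for the atoms `G ≠ F` of `q`. -/
def fdsWithout (q : CQ S) (F : Atom S) : Set FD :=
  {σ | ∃ G ∈ q, G ≠ F ∧ σ = ⟨G.keyVars, G.vars⟩}

/-- The variables of `q` that are determined by `key(F)` through the other atoms of `q`. -/
def keyClosure (q : CQ S) (F : Atom S) : Set Var :=
  {x | x ∈ q.vars ∧ FD.Implies (q.fdsWithout F) ⟨F.keyVars, {x}⟩}

/-- The atom `F` attacks the variable `x`. -/
def AttacksVar (q : CQ S) (F : Atom S) (x : Var) : Prop :=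
  ∃ (m : ℕ) (w : Fin (m + 1) → Var), w 0 ∈ F.notKeyVars ∧ w (Fin.last m) = x ∧
    (∀ i, w i ∉ q.keyClosure F) ∧
    ∀ i : Fin m, ∃ G ∈ q, w i.castSucc ∈ G.vars ∧ w i.succ ∈ G.vars

/-- The edges of the attack graph, a loopless directed graph on the atoms of `q`. -/
def Attacks (q : CQ S) (F G : Atom S) : Prop :=
  F ∈ q ∧ G ∈ q ∧ F ≠ G ∧ ∃ x ∈ G.vars, q.AttacksVar F x

/-- The attack graph has no directed cycle. -/
def AcyclicAttackGraph (q : CQ S) : Prop :=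
  ∀ F, ¬ Relation.TransGen q.Attacks F F

end CQ

/-! ## Aggregation queries and greatest lower bounds over repairs -/

/-- A query `AGG(r) ← q(y)` with self-join-free body; `r` is a numerical variable of the body or a
non-negative rational number. -/
structure AggQuery (S : Schema) where
  op : AggOp
  head : NumPrim
  body : CQ S
  selfJoinFree : body.SelfJoinFree
  head_vars : head.vars ⊆ body.vars

namespace AggQuery

variable {S : Schema}

/-- The numerical term `Aggr_AGG y [r, q(y)]`. -/
def toNumTerm (g : AggQuery S) : NumTerm S :=
  .agg g.op g.body.vars g.head g.body.body

/-- `a` is the answer to `GLB-CQA(g())` on `db`: it is `⊥` (that is, `none`) if some repair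
falsifies the body, and otherwise the least value of the query over all repairs. -/
def IsGlbCQA (g : AggQuery S) (db : Database S) : Option NNRat → Prop
  | none => ∃ r, db.IsRepair r ∧ ¬ g.body.SatisfiedIn r
  | some v => (∀ r, db.IsRepair r → g.body.SatisfiedIn r) ∧
      IsLeast {u : NNRat | ∃ r, db.IsRepair r ∧ g.toNumTerm.value r = some u} v

/-- Some numerical query of first-order logic with aggregation computes `GLB-CQA(g())` on every
database instance. -/
def GlbExpressible (g : AggQuery S) : Prop :=
  ∃ t : NumTerm S, t.IsNumQuery ∧ ∀ db : Database S, g.IsGlbCQA db (t.value db)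

end AggQuery

/-! ## Repairs -/

namespace DbFact

variable {S : Schema}

-- Two independent arguments combine. The first concerns the minimum. A repair is a subset of the
-- instance, so it admits fewer valuations and its minimum cannot be smaller. Conversely, since
-- relation names are distinct, the image of the body under a minimizing valuation is consistent,
-- hence lies in a repair, and that repair attains the minimum (`isGlbCQA_some`). Once the body is
-- certain, the bound is therefore the value on the instance itself, and it remains to test
-- certainty by a first-order sentence.
--
-- The second argument is a recursion on atoms, carried out with a growing set `V` of variables
-- whose values are fixed. An acyclic attack graph has an unattacked atom `F`. Different repairs
-- might satisfy the query with different values for the key of `F`, but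
-- `CertainRel.exists_instantiation` provides one choice that serves all repairs. It rests on
-- `exists_merge`: two valuations whose images clash only in the block of an atom can be glued,
-- taking one on the attacked variables and the other elsewhere. With the key fixed, a repair may
-- pick any fact of the block. So certainty says that the block is nonempty and that each of its
-- facts matches `F` with the remaining atoms certain once all variables of `F` are fixed
-- (`certainRel_iff`). Fixing these variables creates no attacks, so the recursion continues and can
-- be written as a formula (`exists_rewriting`).

theorem KeyEqual.refl (A : DbFact S) : A.KeyEqual A := ⟨rfl, fun _ _ => rfl⟩

theorem KeyEqual.symm {A B : DbFact S} (h : A.KeyEqual B) : B.KeyEqual A := by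
  obtain ⟨R, a, ha⟩ := A
  obtain ⟨R', b, hb⟩ := B
  obtain ⟨h, h'⟩ := h
  obtain rfl : R = R' := h
  exact ⟨rfl, fun i hi => (h' i hi).symm⟩

theorem KeyEqual.trans {A B C : DbFact S} (h : A.KeyEqual B) (k : B.KeyEqual C) :
    A.KeyEqual C := by
  obtain ⟨R, a, ha⟩ := A
  obtain ⟨R', b, hb⟩ := B
  obtain ⟨R'', c, hc⟩ := C
  obtain ⟨h, h'⟩ := h
  obtain ⟨k, k'⟩ := k
  obtain rfl : R = R' := h
  obtain rfl : R = R'' := k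
  exact ⟨rfl, fun i hi => (h' i hi).trans (k' i hi)⟩

theorem KeyEqual.rel_eq {A B : DbFact S} (h : A.KeyEqual B) : A.rel = B.rel := h.1

end DbFact

namespace Database

variable {S : Schema} {db r : Database S}

theorem exists_isRepair_superset (s : Database S) (hs : s ⊆ db) (hc : s.Consistent) :
    ∃ r, db.IsRepair r ∧ s ⊆ r := by
  have hfin : {t : Database S | t ⊆ db ∧ t.Consistent}.Finite :=
    (Finset.finite_toSet db.powerset).subset fun t ht => by simpa using ht.1
  obtain ⟨r, hsr, hr⟩ := hfin.exists_le_maximal (a := s) ⟨hs, hc⟩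
  exact ⟨r, hr, hsr⟩

theorem exists_isRepair (db : Database S) : ∃ r, db.IsRepair r := by
  obtain ⟨r, hr, -⟩ := exists_isRepair_superset (db := db) ∅ (by simp) (fun A hA => by simp at hA)
  exact ⟨r, hr⟩

theorem exists_isRepair_mem {A : DbFact S} (hA : A ∈ db) : ∃ r, db.IsRepair r ∧ A ∈ r := by
  obtain ⟨r, hr, h⟩ := exists_isRepair_superset (db := db) {A} (by simpa using hA)
    (fun B hB C hC _ => by simp_all)
  exact ⟨r, hr, h (by simp)⟩

/-- Maximality means meeting every block: a fact whose block is missed could be added, and a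
consistent superset has no room for a second fact in a block already met. -/
theorem isRepair_iff :
    db.IsRepair r ↔ r ⊆ db ∧ r.Consistent ∧ ∀ A ∈ db, ∃ B ∈ r, A.KeyEqual B := by
  classical
  constructor
  · intro h
    refine ⟨h.1.1, h.1.2, fun A hA => ?_⟩
    by_contra! hno
    have hc : (insert A r : Database S).Consistent := by
      intro B hB C hC hBC
      rcases Finset.mem_insert.1 hB with hB' | hB' <;> rcases Finset.mem_insert.1 hC with hC' | hC'
      · exact hB'.trans hC'.symm
      · exact absurd (hB' ▸ hBC) (hno _ hC')
      · exact absurd (hC' ▸ hBC.symm) (hno _ hB')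
      · exact h.1.2 B hB' C hC' hBC
    have := h.2 ⟨Finset.insert_subset hA h.1.1, hc⟩ (Finset.subset_insert A r)
    exact hno A (this (Finset.mem_insert_self _ _)) (.refl A)
  · rintro ⟨hr, hc, hex⟩
    refine ⟨⟨hr, hc⟩, fun s hs hrs A hA => ?_⟩
    obtain ⟨B, hB, hAB⟩ := hex A (hs.1 hA)
    rwa [hs.2 A hA B (hrs hB) hAB]

open Classical in
/-- Exchanging a fact of a repair for another one of the same block. -/
theorem IsRepair.exchange (hr : db.IsRepair r) {A B : DbFact S} (hA : A ∈ db) (hB : B ∈ r)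
    (hAB : A.KeyEqual B) : db.IsRepair (insert A (r.erase B)) := by
  rw [isRepair_iff] at hr ⊢
  obtain ⟨hsub, hc, hex⟩ := hr
  refine ⟨Finset.insert_subset hA ((Finset.erase_subset _ _).trans hsub), ?_, fun C hC => ?_⟩
  · have key : ∀ C ∈ r.erase B, ¬ A.KeyEqual C := fun C hC h =>
      (Finset.mem_erase.1 hC).1 (hc C (Finset.mem_erase.1 hC).2 B hB (h.symm.trans hAB))
    intro C hC D hD hCD
    rcases Finset.mem_insert.1 hC with hC' | hC' <;> rcases Finset.mem_insert.1 hD with hD' | hD'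
    · exact hC'.trans hD'.symm
    · exact absurd (hC' ▸ hCD) (key _ hD')
    · exact absurd (hD' ▸ hCD.symm) (key _ hC')
    · exact hc C (Finset.mem_of_mem_erase hC') D (Finset.mem_of_mem_erase hD') hCD
  · obtain ⟨D, hD, hCD⟩ := hex C hC
    by_cases h : D = B
    · subst h
      exact ⟨A, Finset.mem_insert_self _ _, hCD.trans hAB.symm⟩
    · exact ⟨D, Finset.mem_insert_of_mem (Finset.mem_erase.2 ⟨h, hD⟩), hCD⟩

end Database

/-! ## Valuations -/

theorem Atom.mem_vars {S : Schema} {F : Atom S} {x : Var} :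
    x ∈ F.vars ↔ ∃ i, x ∈ (F.args i).vars := by
  simp [Atom.vars]

theorem Atom.mem_keyVars {S : Schema} {F : Atom S} {x : Var} :
    x ∈ F.keyVars ↔ ∃ i : Fin (S.arity F.rel), i.val < S.keyLen F.rel ∧ x ∈ (F.args i).vars := by
  simp [Atom.keyVars]

theorem Atom.keyVars_subset {S : Schema} (F : Atom S) : F.keyVars ⊆ F.vars := by
  intro x hx
  obtain ⟨i, -, hi⟩ := Atom.mem_keyVars.1 hx
  exact Atom.mem_vars.2 ⟨i, hi⟩

namespace VarValuation

variable {S : Schema}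

theorem ext_get {θ τ : VarValuation S} (h : ∀ x, θ.get x = τ.get x) : θ = τ := by
  obtain ⟨o, n⟩ := θ
  obtain ⟨o', n'⟩ := τ
  congr
  · funext k; exact h (.obj k)
  · funext k; exact S.num.injective (h (.num k))

/-- The valuations coincide on `U`. -/
def AgreeOn (U : Set Var) (θ τ : VarValuation S) : Prop := ∀ x ∈ U, θ.get x = τ.get x

theorem AgreeOn.refl (U : Set Var) (θ : VarValuation S) : AgreeOn U θ θ := fun _ _ => rfl

theorem AgreeOn.symm {U : Set Var} {θ τ : VarValuation S} (h : AgreeOn U θ τ) : AgreeOn U τ θ :=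
  fun x hx => (h x hx).symm

theorem AgreeOn.trans {U : Set Var} {θ τ σ : VarValuation S} (h : AgreeOn U θ τ)
    (k : AgreeOn U τ σ) : AgreeOn U θ σ := fun x hx => (h x hx).trans (k x hx)

theorem AgreeOn.mono {U W : Set Var} {θ τ : VarValuation S} (h : AgreeOn U θ τ) (hW : W ⊆ U) :
    AgreeOn W θ τ := fun x hx => h x (hW hx)

theorem AgreeOff.agreeOn {ys : Finset Var} {θ τ : VarValuation S} (h : AgreeOff ys θ τ)
    {U : Set Var} (hU : ∀ x ∈ U, x ∉ ys) : AgreeOn U θ τ := fun x hx => (h x (hU x hx)).symm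

open Classical in
/-- The valuation that coincides with `τ` on `U` and with `θ` elsewhere. -/
noncomputable def override (U : Set Var) (θ τ : VarValuation S) : VarValuation S where
  onObj := fun n => if Var.obj n ∈ U then τ.onObj n else θ.onObj n
  onNum := fun n => if Var.num n ∈ U then τ.onNum n else θ.onNum n

theorem get_override_of_mem {U : Set Var} {θ τ : VarValuation S} {x : Var} (hx : x ∈ U) :
    (override U θ τ).get x = τ.get x := by
  cases x <;> simp [override, get, hx]

theorem get_override_of_notMem {U : Set Var} {θ τ : VarValuation S} {x : Var} (hx : x ∉ U) :
    (override U θ τ).get x = θ.get x := by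
  cases x <;> simp [override, get, hx]

theorem agreeOff_override (ys : Finset Var) (θ τ : VarValuation S) :
    AgreeOff ys θ (override (ys : Set Var) θ τ) :=
  fun _ hx => get_override_of_notMem (by simpa using hx)

theorem termVal_congr {θ τ : VarValuation S} {t : Term S} (h : AgreeOn t.vars θ τ) :
    θ.termVal t = τ.termVal t := by
  cases t with
  | var x => exact h x (by simp [Term.vars])
  | const c => rfl

theorem agreeOn_of_termVal_eq {θ τ : VarValuation S} {t : Term S}
    (h : θ.termVal t = τ.termVal t) : AgreeOn t.vars θ τ := by
  cases t with
  | var x => intro y hy; simp [Term.vars] at hy; subst hy; exact h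
  | const c => intro y hy; simp [Term.vars] at hy

theorem ground_eq_iff {θ τ : VarValuation S} {F : Atom S} :
    θ.ground F = τ.ground F ↔ AgreeOn F.vars θ τ := by
  constructor
  · intro h x hx
    obtain ⟨i, hi⟩ := Atom.mem_vars.1 hx
    have h' : (θ.ground F).args = (τ.ground F).args := by
      simpa [ground] using h
    exact agreeOn_of_termVal_eq (congrFun h' i) x hi
  · intro h
    have h' : (fun i => θ.termVal (F.args i)) = fun i => τ.termVal (F.args i) :=
      funext fun i => termVal_congr fun x hx => h x (Atom.mem_vars.2 ⟨i, hx⟩)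
    simp only [ground, h']

theorem keyEqual_ground_iff {θ τ : VarValuation S} {F : Atom S} :
    (θ.ground F).KeyEqual (τ.ground F) ↔ AgreeOn F.keyVars θ τ := by
  constructor
  · rintro ⟨_, h⟩ x hx
    obtain ⟨i, hk, hi⟩ := Atom.mem_keyVars.1 hx
    exact agreeOn_of_termVal_eq (h i hk) x hi
  · intro h
    exact ⟨rfl, fun i hk => termVal_congr fun x hx => h x (Atom.mem_keyVars.2 ⟨i, hk, hx⟩)⟩

end VarValuation

/-! ## Attacks relative to a set of fixed variables -/

namespace CQ

variable {S : Schema}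

theorem mem_vars {q : CQ S} {x : Var} : x ∈ q.vars ↔ ∃ F ∈ q, x ∈ F.vars := by
  induction q with
  | nil => simp [CQ.vars]
  | cons F q ih => simp only [CQ.vars, List.foldr_cons, Finset.mem_union] at ih ⊢; simp [ih]

theorem SelfJoinFree.eq_of_rel_eq {q : CQ S} (h : q.SelfJoinFree) {F G : Atom S} (hF : F ∈ q)
    (hG : G ∈ q) (hr : F.rel = G.rel) : F = G :=
  List.inj_on_of_nodup_map h hF hG hr

/-- The set `U` of variables is closed under the dependencies of the atoms `G ≠ F` of `q`. -/
def ClosedWithout (q : CQ S) (F : Atom S) (U : Set Var) : Prop :=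
  ∀ G ∈ q, G ≠ F → (G.keyVars : Set Var) ⊆ U → (G.vars : Set Var) ⊆ U

/-- The variables determined by `key(F)` through the other atoms if the values of the variables
in `V` are fixed. -/
def closureRel (q : CQ S) (V : Set Var) (F : Atom S) : Set Var :=
  {x | ∀ U : Set Var, V ⊆ U → (F.keyVars : Set Var) ⊆ U → q.ClosedWithout F U → x ∈ U}

theorem subset_closureRel (q : CQ S) (V : Set Var) (F : Atom S) : V ⊆ q.closureRel V F :=
  fun _ hx _ hV _ _ => hV hx

theorem keyVars_subset_closureRel (q : CQ S) (V : Set Var) (F : Atom S) :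
    (F.keyVars : Set Var) ⊆ q.closureRel V F :=
  fun _ hx _ _ hF _ => hF hx

/-- Links the semantic implication of dependencies to closed sets of variables. This inclusion
suffices: a larger closure leaves fewer attacks, so acyclicity passes to the relative attack graph.
-/
theorem keyClosure_subset_closureRel (q : CQ S) (F : Atom S) :
    q.keyClosure F ⊆ q.closureRel ∅ F := by
  classical
  rintro x ⟨-, hx⟩ U - hF hU
  by_contra hxU
  -- A relation of two tuples that agree exactly on `U`; it satisfies the dependencies because `U`
  -- is closed.
  have hs := hx {fun _ => 0, fun y => if y ∈ U then 0 else 1} ?_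
    (fun _ => 0) (by simp) (fun y => if y ∈ U then 0 else 1) (by simp)
    (fun y hy => by simp [hF hy]) x (by simp)
  · simp [hxU] at hs
  · rintro κ ⟨G, hG, hGF, rfl⟩ s hs t ht hst y hy
    have key : ∀ z, (∀ z ∈ G.keyVars, (if z ∈ U then 0 else 1) = 0) →
        z ∈ G.vars → z ∈ U := by
      intro z h hz
      exact hU G hG hGF (fun w hw => by simpa using h w hw) hz
    rcases hs with rfl | rfl <;> rcases ht with rfl | rfl
    · rfl
    · simp [key y (fun z hz => (hst z hz).symm) hy]
    · simp [key y (fun z hz => hst z hz) hy]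
    · rfl

/-- A step of an attack from `F`. -/
def AttackStep (q : CQ S) (V : Set Var) (F : Atom S) (x y : Var) : Prop :=
  y ∉ q.closureRel V F ∧ ∃ G ∈ q, x ∈ G.vars ∧ y ∈ G.vars

/-- `F` attacks the variable `x` if the values of the variables in `V` are fixed. -/
def AttacksVarRel (q : CQ S) (V : Set Var) (F : Atom S) (x : Var) : Prop :=
  ∃ y ∈ F.vars, y ∉ q.closureRel V F ∧ Relation.ReflTransGen (q.AttackStep V F) y x

theorem AttacksVarRel.notMem_closureRel {q : CQ S} {V : Set Var} {F : Atom S} {x : Var}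
    (h : q.AttacksVarRel V F x) : x ∉ q.closureRel V F := by
  obtain ⟨y, -, hy, h⟩ := h
  rcases h.cases_tail with rfl | ⟨z, -, hz⟩
  · exact hy
  · exact hz.1

theorem AttacksVarRel.attacksVar {q : CQ S} {F : Atom S} {x : Var}
    (h : q.AttacksVarRel ∅ F x) : q.AttacksVar F x := by
  obtain ⟨y, hyF, hy, h⟩ := h
  induction h with
  | refl =>
    refine ⟨0, fun _ => y, ?_, rfl, fun _ h => hy (keyClosure_subset_closureRel q F h),
      fun i => i.elim0⟩
    exact Finset.mem_sdiff.2 ⟨hyF, fun h => hy (keyVars_subset_closureRel q ∅ F h)⟩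
  | @tail b c _ hbc ih =>
    obtain ⟨m, w, h0, hl, hcl, hadj⟩ := ih
    refine ⟨m + 1, Fin.snoc (α := fun _ => Var) w c, ?_, by simp, ?_, ?_⟩
    · rw [← Fin.castSucc_zero, Fin.snoc_castSucc]; exact h0
    · intro i
      refine Fin.lastCases ?_ (fun j => ?_) i
      · rw [Fin.snoc_last]; exact fun h => hbc.1 (keyClosure_subset_closureRel q F h)
      · rw [Fin.snoc_castSucc]; exact hcl j
    · intro i
      refine Fin.lastCases ?_ (fun j => ?_) i
      · rw [Fin.succ_last, Fin.snoc_last, Fin.snoc_castSucc, hl]; exact hbc.2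
      · rw [Fin.succ_castSucc, Fin.snoc_castSucc, Fin.snoc_castSucc]; exact hadj j

/-- The attack graph if the values of the variables in `V` are fixed. -/
def AttacksRel (q : CQ S) (V : Set Var) (F G : Atom S) : Prop :=
  F ∈ q ∧ G ∈ q ∧ F ≠ G ∧ ∃ x ∈ G.vars, q.AttacksVarRel V F x

def AcyclicRel (q : CQ S) (V : Set Var) : Prop :=
  ∀ F, ¬ Relation.TransGen (q.AttacksRel V) F F

theorem AcyclicAttackGraph.acyclicRel {q : CQ S} (h : q.AcyclicAttackGraph) : q.AcyclicRel ∅ :=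
  fun F hF => h F (Relation.TransGen.mono
    (fun _ _ ⟨h1, h2, h3, x, hx, hx'⟩ => ⟨h1, h2, h3, x, hx, hx'.attacksVar⟩) _ _ hF)

open Classical in
/-- The conjunction without the atom `F`. -/
noncomputable def without (q : CQ S) (F : Atom S) : CQ S := q.filter fun G => G ≠ F

theorem mem_without {q : CQ S} {F G : Atom S} : G ∈ q.without F ↔ G ∈ q ∧ G ≠ F := by
  simp [without]

theorem length_without_lt {q : CQ S} {F : Atom S} (hF : F ∈ q) :
    (q.without F).length < q.length := by
  classical
  exact List.length_filter_lt_length_iff_exists.2 ⟨F, hF, by simp⟩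

theorem SelfJoinFree.without {q : CQ S} (h : q.SelfJoinFree) (F : Atom S) :
    (q.without F).SelfJoinFree :=
  h.sublist (List.filter_sublist.map _)

/-- Fixing the variables of an atom and removing it creates no attacks. -/
theorem AcyclicRel.without {q : CQ S} {V : Set Var} (h : q.AcyclicRel V) (F : Atom S) :
    (q.without F).AcyclicRel (V ∪ F.vars) := by
  -- Closures only grow: the lost dependency of `F` is trivial once its variables are fixed.
  have hcl : ∀ G, q.closureRel V G ⊆ (q.without F).closureRel (V ∪ F.vars) G := by
    intro G x hx U hV hG hU
    refine hx U (Set.subset_union_left.trans hV) hG fun H hH hHG hk => ?_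
    by_cases hHF : H = F
    · subst hHF; exact Set.subset_union_right.trans hV
    · exact hU H (mem_without.2 ⟨hH, hHF⟩) hHG hk
  intro G hG
  refine h G (Relation.TransGen.mono ?_ _ _ hG)
  rintro A B ⟨hA, hB, hAB, x, hx, y, hy, hyc, hyx⟩
  refine ⟨(mem_without.1 hA).1, (mem_without.1 hB).1, hAB, x, hx, y, hy, fun h => hyc (hcl _ h), ?_⟩
  exact Relation.ReflTransGen.mono (fun a b ⟨hb, H, hH, hab⟩ =>
    ⟨fun h => hb (hcl _ h), H, (mem_without.1 hH).1, hab⟩) _ _ hyx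

theorem AcyclicRel.exists_unattacked {q : CQ S} {V : Set Var} (h : q.AcyclicRel V) (hq : q ≠ []) :
    ∃ F ∈ q, ∀ G, ¬ q.AttacksRel V G F := by
  classical
  have : Finite {F // F ∈ q} := q.finite_toSet
  let R : {F // F ∈ q} → {F // F ∈ q} → Prop := fun A B => Relation.TransGen (q.AttacksRel V) A B
  have : IsTrans _ R := ⟨fun _ _ _ => Relation.TransGen.trans⟩
  have : Std.Irrefl R := ⟨fun A => h A⟩
  obtain ⟨F₀, hF₀⟩ := List.exists_mem_of_ne_nil q hq
  obtain ⟨F, -, hF⟩ := (Finite.wellFounded_of_trans_of_irrefl R).has_min Set.univ ⟨⟨F₀, hF₀⟩, trivial⟩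
  exact ⟨F, F.2, fun G hG => hF ⟨G, hG.1⟩ trivial (.single hG)⟩

/-! ## Certainty under fixed values of some variables -/

/-- Some valuation that coincides with `θ` on `V` maps `q` into `r`. -/
def SatisfiedRel (q : CQ S) (V : Set Var) (θ : VarValuation S) (r : Database S) : Prop :=
  ∃ τ, VarValuation.AgreeOn V θ τ ∧ ∀ F ∈ q, τ.ground F ∈ r

/-- Every repair satisfies `q` with the variables in `V` fixed as in `θ`. -/
def CertainRel (q : CQ S) (V : Set Var) (θ : VarValuation S) (db : Database S) : Prop :=
  ∀ r, db.IsRepair r → q.SatisfiedRel V θ r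

theorem CertainRel.congr {q : CQ S} {V : Set Var} {θ τ : VarValuation S} {db : Database S}
    (h : q.CertainRel V θ db) (hθ : VarValuation.AgreeOn V θ τ) : q.CertainRel V τ db := by
  intro r hr
  obtain ⟨σ, hσ, h⟩ := h r hr
  exact ⟨σ, hθ.symm.trans hσ, h⟩

theorem certainRel_empty {q : CQ S} {θ : VarValuation S} {db : Database S} :
    q.CertainRel ∅ θ db ↔ q.CertainIn db := by
  refine forall₂_congr fun r _ => ?_
  simp [SatisfiedRel, SatisfiedIn, VarValuation.AgreeOn]

/-- Two valuations into consistent databases that differ in at most one block, that of `F`, can be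
merged along the attacks from `F`. -/
theorem exists_merge {q : CQ S} {V X : Set Var} {F : Atom S}
    (hX : ∀ x ∈ X, ¬ q.AttacksVarRel V F x) {θ₁ θ₂ : VarValuation S}
    (hV : VarValuation.AgreeOn V θ₁ θ₂) (hk : VarValuation.AgreeOn F.keyVars θ₁ θ₂)
    (hcons : ∀ G ∈ q, G ≠ F → (θ₁.ground G).KeyEqual (θ₂.ground G) → θ₁.ground G = θ₂.ground G) :
    ∃ τ : VarValuation S, VarValuation.AgreeOn V θ₂ τ ∧ VarValuation.AgreeOn X θ₂ τ ∧
      τ.ground F = θ₁.ground F ∧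
      ∀ G ∈ q, G ≠ F → τ.ground G = θ₁.ground G ∨ τ.ground G = θ₂.ground G := by
  -- The variables on which both valuations agree contain `V` and the key of `F`, and by `hcons`
  -- they form a closed set.
  have hcl : VarValuation.AgreeOn (q.closureRel V F) θ₁ θ₂ := by
    intro x hx
    refine hx {x | θ₁.get x = θ₂.get x} hV hk fun G hG hGF hGk => ?_
    exact VarValuation.ground_eq_iff.1 (hcons G hG hGF (VarValuation.keyEqual_ground_iff.2 hGk))
  -- The merged valuation follows `θ₁` on attacked variables and `θ₂` elsewhere. In an atom with an
  -- attacked variable, every other variable is attacked too or lies in the closure, where both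
  -- agree; so no atom mixes the two.
  set W : Set Var := {x | q.AttacksVarRel V F x} with hW
  have hon : ∀ x, x ∈ W ∨ x ∈ q.closureRel V F →
      (VarValuation.override W θ₂ θ₁).get x = θ₁.get x := by
    intro x hx
    by_cases hxW : x ∈ W
    · exact VarValuation.get_override_of_mem hxW
    · rw [VarValuation.get_override_of_notMem hxW, hcl x (hx.resolve_left hxW)]
  refine ⟨VarValuation.override W θ₂ θ₁, fun x hx => ?_, fun x hx => ?_, ?_, fun G hG hGF => ?_⟩
  · exact (VarValuation.get_override_of_notMem
      fun h : q.AttacksVarRel V F x => h.notMem_closureRel (subset_closureRel q V F hx)).symm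
  · exact (VarValuation.get_override_of_notMem (hX x hx)).symm
  · refine VarValuation.ground_eq_iff.2 fun x hx => hon x ?_
    by_cases h : x ∈ q.closureRel V F
    · exact .inr h
    · exact .inl ⟨x, hx, h, .refl⟩
  · by_cases h : ∃ x ∈ G.vars, x ∈ W
    · obtain ⟨x, hx, y, hyF, hy, hyx⟩ := h
      refine .inl (VarValuation.ground_eq_iff.2 fun z hz => hon z ?_)
      by_cases hzc : z ∈ q.closureRel V F
      · exact .inr hzc
      · exact .inl ⟨y, hyF, hy, hyx.tail ⟨hzc, G, hG, hx, hz⟩⟩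
    · push Not at h
      exact .inr (VarValuation.ground_eq_iff.2 fun z hz =>
        VarValuation.get_override_of_notMem (h z hz))

/-- Unattacked variables can be instantiated uniformly over all repairs. -/
theorem CertainRel.exists_instantiation {q : CQ S} (hsjf : q.SelfJoinFree) {V X : Set Var}
    (hX : ∀ F ∈ q, ∀ x ∈ X, ¬ q.AttacksVarRel V F x) {θ : VarValuation S} {db : Database S}
    (h : q.CertainRel V θ db) :
    ∃ τ, VarValuation.AgreeOn V θ τ ∧ q.CertainRel (V ∪ X) τ db := by
  classical
  let Q : Database S → Set (VarValuation S) := fun r =>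
    {τ | VarValuation.AgreeOn V θ τ ∧ q.SatisfiedRel (V ∪ X) τ r}
  have hfin : {r : Database S | db.IsRepair r}.Finite :=
    (Finset.finite_toSet db.powerset).subset fun t ht => by simpa using ht.1.1
  -- A repair with an inclusion-minimal set of admissible instantiations. The claim `key` makes this
  -- set a least one, so any of its elements works in all repairs.
  obtain ⟨r, hr, hmin⟩ := hfin.exists_minimalFor Q _ db.exists_isRepair
  have key : ∀ n : ℕ, ∀ s, db.IsRepair s → (s \ r).card = n → Q r ⊆ Q s := by
    intro n
    induction n using Nat.strong_induction_on with
    | _ n ih =>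
    intro s hs hn
    by_contra hcon
    -- If every embedding into `s` already lies in `r`, then `Q s ⊆ Q r`, and minimality gives the
    -- reverse inclusion, against `hcon`.
    have hirr : ∀ σ : VarValuation S, VarValuation.AgreeOn V θ σ → (∀ F ∈ q, σ.ground F ∈ s) →
        ∀ F ∈ q, σ.ground F ∈ r := by
      intro σ hσV hσ F hF
      by_contra hB
      have hs' := Database.isRepair_iff.1 hs
      obtain ⟨A, hA, hBA⟩ := (Database.isRepair_iff.1 hr).2.2 _ (hs'.1 (hσ F hF))
      have hAs : A ∉ s := fun hAs => hB (by rw [hs'.2.1 _ (hσ F hF) A hAs hBA]; exact hA)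
      -- Replacing a fact used by `σ` but missing from `r` by the fact of `r` in its block brings
      -- `s` closer to `r`, so induction applies. It remains to see that the exchange adds no
      -- instantiation.
      have hex := hs.exchange ((Database.isRepair_iff.1 hr).1 hA) (hσ F hF) hBA.symm
      have hlt : (insert A (s.erase (σ.ground F)) \ r).card < n := by
        rw [← hn]
        refine Finset.card_lt_card ((Finset.ssubset_iff_of_subset fun C hC => ?_).2
          ⟨σ.ground F, Finset.mem_sdiff.2 ⟨hσ F hF, hB⟩, ?_⟩)
        · obtain ⟨hC, hCr⟩ := Finset.mem_sdiff.1 hC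
          rcases Finset.mem_insert.1 hC with rfl | hC
          · exact absurd hA hCr
          · exact Finset.mem_sdiff.2 ⟨Finset.mem_of_mem_erase hC, hCr⟩
        · intro hC
          rcases Finset.mem_insert.1 (Finset.mem_sdiff.1 hC).1 with h | h
          · exact hB (h ▸ hA)
          · simp at h
      refine hcon ((ih _ hlt _ hex rfl).trans ?_)
      rintro τ ⟨hτV, ρ, hρ, hρq⟩
      refine ⟨hτV, ?_⟩
      by_cases hρA : ∀ G ∈ q, ρ.ground G ≠ A
      · refine ⟨ρ, hρ, fun G hG => ?_⟩
        exact Finset.mem_of_mem_erase ((Finset.mem_insert.1 (hρq G hG)).resolve_left (hρA G hG))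
      push Not at hρA
      obtain ⟨G, hG, rfl⟩ := hρA
      obtain rfl : F = G := hsjf.eq_of_rel_eq hF hG hBA.rel_eq
      have hin : ∀ G ∈ q, G ≠ F → ρ.ground G ∈ s := fun G hG hGF =>
        Finset.mem_of_mem_erase ((Finset.mem_insert.1 (hρq G hG)).resolve_left fun h =>
          hGF (hsjf.eq_of_rel_eq hG hF (congrArg DbFact.rel h)))
      -- An embedding `ρ` that uses the new fact is merged with `σ`: the result sends `F` back to
      -- the old fact, stays in `s`, and keeps the values of `ρ` on `V` and on the unattacked `X`.
      obtain ⟨μ, hμV, hμX, hμF, hμ⟩ := exists_merge (hX F hF)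
        (hσV.symm.trans (hτV.trans (hρ.mono Set.subset_union_left)))
        (VarValuation.keyEqual_ground_iff.1 hBA)
        (fun G hG hGF hk => hs'.2.1 _ (hσ G hG) _ (hin G hG hGF) hk)
      refine ⟨μ, fun x hx => (hρ x hx).trans ?_, fun G hG => ?_⟩
      · exact hx.elim (hμV x) (hμX x)
      · by_cases hGF : G = F
        · subst hGF; rw [hμF]; exact hσ _ hF
        · rcases hμ G hG hGF with h | h <;> rw [h]
          exacts [hσ G hG, hin G hG hGF]
    refine hcon (hmin hs ?_)
    rintro τ ⟨hτV, ρ, hρ, hρq⟩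
    exact ⟨hτV, ρ, hρ, hirr ρ (hτV.trans (hρ.mono Set.subset_union_left)) hρq⟩
  obtain ⟨τ, hτ, hτr⟩ := h r hr
  refine ⟨τ, hτ, fun s hs => ?_⟩
  exact (key _ s hs rfl ⟨hτ, τ, .refl _ _, hτr⟩).2

/-- The recursive description of certainty along an unattacked atom. -/
theorem certainRel_iff {q : CQ S} (hsjf : q.SelfJoinFree) {V : Set Var} {F : Atom S} (hF : F ∈ q)
    (hatt : ∀ G, ¬ q.AttacksRel V G F) {θ : VarValuation S} {db : Database S} :
    q.CertainRel V θ db ↔ ∃ τ, VarValuation.AgreeOn V θ τ ∧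
      (∃ A ∈ db, (τ.ground F).KeyEqual A) ∧
      ∀ A ∈ db, (τ.ground F).KeyEqual A → ∃ σ, VarValuation.AgreeOn (V ∪ F.keyVars) τ σ ∧
        σ.ground F = A ∧ (q.without F).CertainRel (V ∪ F.vars) σ db := by
  classical
  constructor
  · intro h
    obtain ⟨τ, hτ, h⟩ := h.exists_instantiation hsjf (X := F.keyVars) fun G hG x hx hGx => by
      by_cases hGF : G = F
      · subst hGF; exact hGx.notMem_closureRel (keyVars_subset_closureRel q V G hx)
      · exact hatt G ⟨hG, hF, hGF, x, F.keyVars_subset hx, hGx⟩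
    have hkey : ∀ ρ, VarValuation.AgreeOn (V ∪ F.keyVars) τ ρ →
        (τ.ground F).KeyEqual (ρ.ground F) := fun ρ hρ =>
      VarValuation.keyEqual_ground_iff.2 (hρ.mono Set.subset_union_right)
    refine ⟨τ, hτ, ?_, fun A hA hk => ?_⟩
    · obtain ⟨r, hr⟩ := db.exists_isRepair
      obtain ⟨ρ, hρ, hρr⟩ := h r hr
      exact ⟨_, hr.1.1 (hρr F hF), hkey ρ hρ⟩
    · obtain ⟨r, hr, hAr⟩ := Database.exists_isRepair_mem hA
      obtain ⟨σ, hσ, hσr⟩ := h r hr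
      have hσA : σ.ground F = A := hr.1.2 _ (hσr F hF) A hAr ((hkey σ hσ).symm.trans hk)
      refine ⟨σ, hσ, hσA, fun s hs => ?_⟩
      -- An arbitrary repair is altered to contain `A`, which forces the embedding to send `F` to
      -- `A`. The other atoms have other relation names, so their images already lie in `s`.
      obtain ⟨B, hB, hAB⟩ := (Database.isRepair_iff.1 hs).2.2 A hA
      have hex := hs.exchange hA hB hAB
      obtain ⟨ρ, hρ, hρs⟩ := h _ hex
      have hρA : ρ.ground F = A := hex.1.2 _ (hρs F hF) A (Finset.mem_insert_self _ _)
        ((hkey ρ hρ).symm.trans hk)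
      refine ⟨ρ, ?_, fun G hG => ?_⟩
      · rintro x (hx | hx)
        · rw [← hσ x (.inl hx), hρ x (.inl hx)]
        · exact VarValuation.ground_eq_iff.1 (hσA.trans hρA.symm) x hx
      · obtain ⟨hG, hGF⟩ := mem_without.1 hG
        refine Finset.mem_of_mem_erase ((Finset.mem_insert.1 (hρs G hG)).resolve_left fun h => ?_)
        exact hGF (hsjf.eq_of_rel_eq hG hF (congrArg DbFact.rel (h.trans hρA.symm)))
  · rintro ⟨τ, hτ, ⟨A, hA, hAk⟩, h⟩ r hr
    obtain ⟨B, hB, hAB⟩ := (Database.isRepair_iff.1 hr).2.2 A hA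
    obtain ⟨σ, hσ, hσB, hc⟩ := h B (hr.1.1 hB) (hAk.trans hAB)
    obtain ⟨ρ, hρ, hρr⟩ := hc r hr
    refine ⟨ρ, hτ.trans ((hσ.mono Set.subset_union_left).trans (hρ.mono Set.subset_union_left)),
      fun G hG => ?_⟩
    by_cases hGF : G = F
    · subst hGF
      rw [← VarValuation.ground_eq_iff.2 (hρ.mono Set.subset_union_right), hσB]
      exact hB
    · exact hρr G (mem_without.2 ⟨hG, hGF⟩)

end CQ

/-! ## Derived connectives -/

namespace Formula

variable {S : Schema}

def conj (l : List (Formula S)) : Formula S := l.foldr .and .verum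

theorem holds_conj {l : List (Formula S)} {db : Database S} {θ : VarValuation S} :
    (conj l).Holds db θ ↔ ∀ φ ∈ l, φ.Holds db θ := by
  induction l with
  | nil => simp [conj, Holds]
  | cons φ l ih => simp only [conj, List.foldr_cons, Holds] at ih ⊢; simp [ih]

theorem freeVars_conj_subset {l : List (Formula S)} {U : Finset Var}
    (h : ∀ φ ∈ l, φ.freeVars ⊆ U) : (conj l).freeVars ⊆ U := by
  induction l with
  | nil => simp [conj, freeVars]
  | cons φ l ih =>
    simp only [conj, List.foldr_cons, freeVars] at ih ⊢
    exact Finset.union_subset (h φ (by simp)) (ih fun ψ hψ => h ψ (by simp [hψ]))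

theorem wellFormed_conj {l : List (Formula S)} (h : ∀ φ ∈ l, φ.WellFormed) :
    (conj l).WellFormed := by
  induction l with
  | nil => simp [conj, WellFormed]
  | cons φ l ih =>
    simp only [conj, List.foldr_cons, WellFormed] at ih ⊢
    exact ⟨h φ (by simp), ih fun ψ hψ => h ψ (by simp [hψ])⟩

/-- Existential quantification over a finite set of variables. -/
noncomputable def exs (ys : Finset Var) (φ : Formula S) : Formula S := ys.toList.foldr .ex φ

theorem holds_foldr_ex {l : List Var} {φ : Formula S} {db : Database S} {θ : VarValuation S} :
    (l.foldr .ex φ : Formula S).Holds db θ ↔ ∃ τ, θ.AgreeOff l.toFinset τ ∧ φ.Holds db τ := by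
  induction l generalizing θ with
  | nil =>
    simp only [List.foldr_nil, List.toFinset_nil]
    refine ⟨fun h => ⟨θ, fun _ _ => rfl, h⟩, ?_⟩
    rintro ⟨τ, hτ, h⟩
    rwa [← VarValuation.ext_get fun x => hτ x (by simp)]
  | cons x l ih =>
    simp only [List.foldr_cons, Holds, ih]
    constructor
    · rintro ⟨σ, hσ, τ, hτ, h⟩
      refine ⟨τ, fun y hy => ?_, h⟩
      simp only [List.toFinset_cons, Finset.mem_insert, not_or] at hy
      rw [hτ y hy.2, hσ y (by simpa using hy.1)]
    · rintro ⟨τ, hτ, h⟩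
      refine ⟨.override {x} θ τ, fun y hy => ?_, τ, fun y hy => ?_, h⟩
      · exact VarValuation.get_override_of_notMem (by simpa using hy)
      · by_cases hyx : y = x
        · subst hyx
          exact (VarValuation.get_override_of_mem (Set.mem_singleton _)).symm
        · rw [VarValuation.get_override_of_notMem (by simpa using hyx)]
          exact hτ y (by simp only [List.toFinset_cons, Finset.mem_insert]; tauto)

theorem holds_exs {ys : Finset Var} {φ : Formula S} {db : Database S} {θ : VarValuation S} :
    (exs ys φ).Holds db θ ↔ ∃ τ, θ.AgreeOff ys τ ∧ φ.Holds db τ := by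
  rw [exs, holds_foldr_ex, Finset.toList_toFinset]

theorem freeVars_exs (ys : Finset Var) (φ : Formula S) :
    (exs ys φ).freeVars = φ.freeVars \ ys := by
  have : ∀ l : List Var, (l.foldr .ex φ : Formula S).freeVars = φ.freeVars \ l.toFinset := by
    intro l
    induction l with
    | nil => simp
    | cons x l ih => ext y; simp only [List.foldr_cons, freeVars, ih]; simp; tauto
  rw [exs, this, Finset.toList_toFinset]

theorem freeVars_exs_subset {ys U : Finset Var} {φ : Formula S} :
    (exs ys φ).freeVars ⊆ U ↔ φ.freeVars ⊆ U ∪ ys := by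
  rw [freeVars_exs]
  exact sdiff_le_iff'

theorem wellFormed_exs {ys : Finset Var} {φ : Formula S} (h : φ.WellFormed) :
    (exs ys φ).WellFormed := by
  unfold exs
  induction ys.toList with
  | nil => exact h
  | cons x l ih => simpa only [List.foldr_cons, WellFormed] using ih

end Formula

/-! ## First-order rewriting of certainty -/

namespace Var

def index : Var → ℕ
  | .obj n => n
  | .num n => n

end Var

namespace Atom

variable {S : Schema}

open Classical in
/-- The variable at position `i` of `F.fresh N`. -/
noncomputable def freshVar (F : Atom S) (N : ℕ) (i : Fin (S.arity F.rel)) : Var :=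
  if i ∈ S.numeric F.rel then .num (N + i) else .obj (N + i)

theorem index_freshVar (F : Atom S) (N : ℕ) (i : Fin (S.arity F.rel)) :
    (F.freshVar N i).index = N + i := by
  unfold freshVar; split <;> rfl

/-- The atom with the relation name of `F` and pairwise distinct variables of index at
least `N`. -/
noncomputable def fresh (F : Atom S) (N : ℕ) : Atom S where
  rel := F.rel
  args := fun i => .var (F.freshVar N i)
  numeric_args := fun j hj => ⟨.var (N + j), by simp [freshVar, hj, NumPrim.toTerm]⟩

theorem mem_vars_fresh {F : Atom S} {N : ℕ} {x : Var} :
    x ∈ (F.fresh N).vars ↔ ∃ i, x = F.freshVar N i := by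
  rw [mem_vars]
  simp only [fresh, Term.vars, Finset.mem_singleton]

theorem le_index_of_mem_vars_fresh {F : Atom S} {N : ℕ} {x : Var} (h : x ∈ (F.fresh N).vars) :
    N ≤ x.index := by
  obtain ⟨i, rfl⟩ := mem_vars_fresh.1 h
  rw [index_freshVar]; omega

/-- With pairwise distinct variables of the right sort, the pattern reaches every fact of the
relation, whereas constants, repeated or fixed variables in `F` may exclude facts of its block. -/
theorem exists_ground_fresh (F : Atom S) (N : ℕ) (θ : VarValuation S) (A : DbFact S)
    (hA : A.rel = F.rel) :
    ∃ τ, θ.AgreeOff (F.fresh N).vars τ ∧ τ.ground (F.fresh N) = A := by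
  classical
  obtain ⟨R, a, ha⟩ := A
  obtain rfl : R = F.rel := hA
  have hnum : ∀ i : Fin (S.arity F.rel), ∃ c : NNRat, i ∈ S.numeric F.rel → a i = S.num c := by
    intro i
    by_cases h : i ∈ S.numeric F.rel
    · obtain ⟨c, hc⟩ := ha i h
      exact ⟨c, fun _ => hc.symm⟩
    · exact ⟨0, fun h' => absurd h' h⟩
  choose c hc using hnum
  let σ : VarValuation S :=
    { onObj := fun n => if h : n - N < S.arity F.rel then a ⟨n - N, h⟩ else S.num 0
      onNum := fun n => if h : n - N < S.arity F.rel then c ⟨n - N, h⟩ else 0 }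
  refine ⟨.override (F.fresh N).vars θ σ, VarValuation.agreeOff_override _ _ _, ?_⟩
  have harg : ∀ i, (VarValuation.override ((F.fresh N).vars : Set Var) θ σ).get (F.freshVar N i)
      = a i := by
    intro i
    rw [VarValuation.get_override_of_mem (mem_vars_fresh.2 ⟨i, rfl⟩)]
    unfold freshVar
    split_ifs with h
    · simp [VarValuation.get, σ, hc i h]
    · simp [VarValuation.get, σ]
  simp only [VarValuation.ground, fresh, VarValuation.termVal]
  congr
  exact funext harg

/-- The arguments of `F` coincide with those of `F.fresh N` at the positions with property `p`. -/
noncomputable def matching (F : Atom S) (N : ℕ) (p : Fin (S.arity F.rel) → Bool) : Formula S :=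
  .conj (((List.finRange (S.arity F.rel)).filter p).map fun i =>
    .eq (F.args i) (.var (F.freshVar N i)))

theorem holds_matching {F : Atom S} {N : ℕ} {p : Fin (S.arity F.rel) → Bool} {db : Database S}
    {θ : VarValuation S} : (F.matching N p).Holds db θ ↔
      ∀ i, p i = true → θ.termVal (F.args i) = θ.get (F.freshVar N i) := by
  simp [matching, Formula.holds_conj, Formula.Holds, VarValuation.termVal]

theorem wellFormed_matching (F : Atom S) (N : ℕ) (p : Fin (S.arity F.rel) → Bool) :
    (F.matching N p).WellFormed :=
  Formula.wellFormed_conj fun φ hφ => by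
    obtain ⟨i, -, rfl⟩ := List.mem_map.1 hφ
    simp [Formula.WellFormed]

theorem freeVars_matching_subset {F : Atom S} {N : ℕ} {p : Fin (S.arity F.rel) → Bool}
    {U : Finset Var} (h : ∀ i, p i = true → (F.args i).vars ⊆ U) (hU : (F.fresh N).vars ⊆ U) :
    (F.matching N p).freeVars ⊆ U :=
  Formula.freeVars_conj_subset fun φ hφ => by
    obtain ⟨i, hi, rfl⟩ := List.mem_map.1 hφ
    simp only [Formula.freeVars]
    refine Finset.union_subset (h i (by simpa using hi)) ?_
    simpa [Term.vars] using hU (mem_vars_fresh.2 ⟨i, rfl⟩)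

noncomputable def matchingKey (F : Atom S) (N : ℕ) : Formula S :=
  F.matching N fun i => decide (i.val < S.keyLen F.rel)

theorem holds_matchingKey {F : Atom S} {N : ℕ} {db : Database S} {θ : VarValuation S} :
    (F.matchingKey N).Holds db θ ↔ (θ.ground F).KeyEqual (θ.ground (F.fresh N)) := by
  rw [matchingKey, holds_matching]
  constructor
  · intro h
    exact ⟨rfl, fun i hi => h i (decide_eq_true hi)⟩
  · rintro ⟨_, h⟩ i hi
    exact h i (of_decide_eq_true hi)

theorem freeVars_matchingKey_subset (F : Atom S) (N : ℕ) :
    (F.matchingKey N).freeVars ⊆ F.keyVars ∪ (F.fresh N).vars :=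
  freeVars_matching_subset (fun i hi _ hx => Finset.mem_union_left _
    (mem_keyVars.2 ⟨i, by simpa using hi, hx⟩)) Finset.subset_union_right

noncomputable def matchingAll (F : Atom S) (N : ℕ) : Formula S := F.matching N fun _ => true

theorem holds_matchingAll {F : Atom S} {N : ℕ} {db : Database S} {θ : VarValuation S} :
    (F.matchingAll N).Holds db θ ↔ θ.ground F = θ.ground (F.fresh N) := by
  rw [matchingAll, holds_matching]
  constructor
  · intro h
    have : (fun i => θ.termVal (F.args i)) = fun i => θ.get (F.freshVar N i) :=
      funext fun i => h i rfl
    change DbFact.mk _ (fun i => θ.termVal (F.args i)) _ =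
      DbFact.mk F.rel (fun i => θ.get (F.freshVar N i)) _
    simp only [this]
  · intro h i _
    have h' : (θ.ground F).args = (θ.ground (F.fresh N)).args := by
      simpa [VarValuation.ground, fresh] using h
    exact congrFun h' i

theorem freeVars_matchingAll_subset (F : Atom S) (N : ℕ) :
    (F.matchingAll N).freeVars ⊆ F.vars ∪ (F.fresh N).vars :=
  freeVars_matching_subset (fun i _ _ hx => Finset.mem_union_left _ (mem_vars.2 ⟨i, hx⟩))
    Finset.subset_union_right

/-- The rewriting for an unattacked atom `F`, where `φ` is a rewriting for the other atoms:
some block of `F` is nonempty, and every fact of it matches `F` in a way that satisfies `φ`. -/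
noncomputable def blockFormula (F : Atom S) (N : ℕ) (V : Finset Var) (φ : Formula S) : Formula S :=
  .exs (F.keyVars \ V) (.and
    (.exs (F.fresh N).vars (.and (.atom (F.fresh N)) (F.matchingKey N)))
    (.neg (.exs (F.fresh N).vars (.and (.and (.atom (F.fresh N)) (F.matchingKey N))
      (.neg (.exs (F.vars \ (V ∪ F.keyVars)) (.and (F.matchingAll N) φ)))))))

theorem wellFormed_blockFormula (F : Atom S) (N : ℕ) (V : Finset Var) {φ : Formula S}
    (hφ : φ.WellFormed) : (F.blockFormula N V φ).WellFormed := by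
  have h1 : (F.matchingKey N).WellFormed := F.wellFormed_matching N _
  have h2 : (F.matchingAll N).WellFormed := F.wellFormed_matching N _
  refine Formula.wellFormed_exs ⟨Formula.wellFormed_exs ⟨trivial, h1⟩, ?_⟩
  exact Formula.wellFormed_exs (φ := .and _ (.neg _)) ⟨⟨trivial, h1⟩, Formula.wellFormed_exs ⟨h2, hφ⟩⟩

theorem freeVars_blockFormula_subset (F : Atom S) (N : ℕ) (V : Finset Var) {φ : Formula S}
    (hφ : φ.freeVars ⊆ V ∪ F.vars) : (F.blockFormula N V φ).freeVars ⊆ V := by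
  have h1 := freeVars_matchingKey_subset F N
  have h2 := freeVars_matchingAll_subset F N
  have hk : F.keyVars ⊆ V ∪ F.keyVars \ V := by
    rw [Finset.union_sdiff_self_eq_union]; exact Finset.subset_union_right
  have hv : F.vars ⊆ V ∪ F.keyVars \ V ∪ F.vars \ (V ∪ F.keyVars) := by
    rw [Finset.union_sdiff_self_eq_union, Finset.union_sdiff_self_eq_union]
    exact Finset.subset_union_right
  have hkey : (F.matchingKey N).freeVars ⊆ V ∪ F.keyVars \ V ∪ (F.fresh N).vars :=
    h1.trans (Finset.union_subset_union_left hk)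
  have hsub : V ∪ F.vars ∪ (F.fresh N).vars ⊆
      V ∪ F.keyVars \ V ∪ (F.fresh N).vars ∪ F.vars \ (V ∪ F.keyVars) := by
    rw [Finset.union_right_comm _ (F.fresh N).vars]
    exact Finset.union_subset_union_left
      (Finset.union_subset (Finset.subset_union_left.trans Finset.subset_union_left) hv)
  simp only [blockFormula, Formula.freeVars, Formula.freeVars_exs_subset, Finset.union_subset_iff]
  refine ⟨⟨Finset.subset_union_right, hkey⟩, ⟨Finset.subset_union_right, hkey⟩, ?_, ?_⟩
  · exact (h2.trans (Finset.union_subset_union_left Finset.subset_union_right)).trans hsub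
  · exact (hφ.trans Finset.subset_union_left).trans hsub

/-- The index bounds keep the quantified pattern variables from disturbing `V` and `F`. By `hP`,
only the values on `V` and the variables of `F` matter for `φ`, so a witness may be overridden to
agree elsewhere with the outer valuation, as the quantifiers demand. -/
theorem holds_blockFormula {F : Atom S} {N : ℕ} {V : Finset Var} {φ : Formula S} {db : Database S}
    (hV : ∀ x ∈ V, x.index < N) (hF : ∀ x ∈ F.vars, x.index < N) {P : VarValuation S → Prop}
    (hP : ∀ θ τ, P θ → VarValuation.AgreeOn ((V : Set Var) ∪ F.vars) θ τ → P τ)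
    (hφ : ∀ θ, φ.Holds db θ ↔ P θ) (θ : VarValuation S) :
    (F.blockFormula N V φ).Holds db θ ↔ ∃ τ, VarValuation.AgreeOn V θ τ ∧
      (∃ A ∈ db, (τ.ground F).KeyEqual A) ∧
      ∀ A ∈ db, (τ.ground F).KeyEqual A →
        ∃ σ, VarValuation.AgreeOn (V ∪ F.keyVars) τ σ ∧ σ.ground F = A ∧ P σ := by
  classical
  have hfV : ∀ x ∈ V, x ∉ (F.fresh N).vars := fun x hx h =>
    absurd (le_index_of_mem_vars_fresh h) (by have := hV x hx; omega)
  have hfF : ∀ x ∈ F.vars, x ∉ (F.fresh N).vars := fun x hx h =>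
    absurd (le_index_of_mem_vars_fresh h) (by have := hF x hx; omega)
  have hfVk : ∀ x ∈ (V : Set Var) ∪ F.keyVars, x ∉ (F.fresh N).vars := by
    rintro x (hx | hx)
    exacts [hfV x hx, hfF x (F.keyVars_subset hx)]
  have hblock : ∀ τ : VarValuation S,
      (∃ ρ, τ.AgreeOff (F.fresh N).vars ρ ∧ ρ.ground (F.fresh N) ∈ db ∧
        (F.matchingKey N).Holds db ρ) ↔ ∃ A ∈ db, (τ.ground F).KeyEqual A := by
    intro τ
    constructor
    · rintro ⟨ρ, hρ, hdb, hk⟩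
      refine ⟨_, hdb, ?_⟩
      rw [VarValuation.ground_eq_iff.2 (hρ.agreeOn hfF)]
      exact holds_matchingKey.1 hk
    · rintro ⟨A, hA, hk⟩
      obtain ⟨ρ, hρ, rfl⟩ := F.exists_ground_fresh N τ A hk.rel_eq.symm
      refine ⟨ρ, hρ, hA, holds_matchingKey.2 ?_⟩
      rwa [← VarValuation.ground_eq_iff.2 (hρ.agreeOn hfF)]
  have hmatch : ∀ τ ρ : VarValuation S, τ.AgreeOff (F.fresh N).vars ρ →
      ((∃ σ, ρ.AgreeOff (F.vars \ (V ∪ F.keyVars)) σ ∧ (F.matchingAll N).Holds db σ ∧ P σ) ↔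
        ∃ σ, VarValuation.AgreeOn ((V : Set Var) ∪ F.keyVars) τ σ ∧
          σ.ground F = ρ.ground (F.fresh N) ∧ P σ) := by
    intro τ ρ hρ
    have hZ : ∀ σ, ρ.AgreeOff (F.vars \ (V ∪ F.keyVars)) σ →
        ρ.ground (F.fresh N) = σ.ground (F.fresh N) := fun σ hσ =>
      VarValuation.ground_eq_iff.2 (hσ.agreeOn fun x hx h => hfF x (Finset.mem_sdiff.1 h).1 hx)
    constructor
    · rintro ⟨σ, hσ, hm, hPσ⟩
      refine ⟨σ, (hρ.agreeOn hfVk).trans (hσ.agreeOn fun x hx h => ?_), ?_, hPσ⟩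
      · exact (Finset.mem_sdiff.1 h).2 (by simpa using hx)
      · rw [hZ σ hσ, holds_matchingAll.1 hm]
    · rintro ⟨σ, hσ, hm, hPσ⟩
      have hoff := VarValuation.agreeOff_override (F.vars \ (V ∪ F.keyVars)) ρ σ
      have hag : VarValuation.AgreeOn ((V : Set Var) ∪ F.vars) σ
          (.override ((F.vars \ (V ∪ F.keyVars) : Finset Var) : Set Var) ρ σ) := by
        intro x hx
        by_cases h : x ∈ F.vars \ (V ∪ F.keyVars)
        · exact (VarValuation.get_override_of_mem h).symm
        · rw [VarValuation.get_override_of_notMem h]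
          have hx' : x ∈ (V : Set Var) ∪ F.keyVars := by
            simp only [Finset.mem_sdiff, Finset.mem_union, Set.mem_union, Finset.mem_coe] at h hx ⊢
            tauto
          rw [← hσ x hx', ← hρ.agreeOn hfVk x hx']
      refine ⟨_, hoff, holds_matchingAll.2 ?_, hP _ _ hPσ hag⟩
      rw [← hZ _ hoff, ← hm]
      exact (VarValuation.ground_eq_iff.2 (hag.mono Set.subset_union_right)).symm
  have hall : ∀ τ : VarValuation S,
      (¬ ∃ ρ, τ.AgreeOff (F.fresh N).vars ρ ∧ (ρ.ground (F.fresh N) ∈ db ∧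
        (F.matchingKey N).Holds db ρ) ∧ ¬ ∃ σ, ρ.AgreeOff (F.vars \ (V ∪ F.keyVars)) σ ∧
          (F.matchingAll N).Holds db σ ∧ P σ) ↔
      ∀ A ∈ db, (τ.ground F).KeyEqual A →
        ∃ σ, VarValuation.AgreeOn ((V : Set Var) ∪ F.keyVars) τ σ ∧ σ.ground F = A ∧ P σ := by
    intro τ
    constructor
    · intro h A hA hk
      obtain ⟨ρ, hρ, rfl⟩ := F.exists_ground_fresh N τ A hk.rel_eq.symm
      by_contra hno
      refine h ⟨ρ, hρ, ⟨hA, holds_matchingKey.2 ?_⟩, fun h' => hno ((hmatch τ ρ hρ).1 h')⟩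
      rwa [← VarValuation.ground_eq_iff.2 (hρ.agreeOn hfF)]
    · rintro h ⟨ρ, hρ, ⟨hdb, hk⟩, hno⟩
      refine hno ((hmatch τ ρ hρ).2 (h _ hdb ?_))
      rw [VarValuation.ground_eq_iff.2 (hρ.agreeOn hfF)]
      exact holds_matchingKey.1 hk
  simp only [blockFormula, Formula.holds_exs, Formula.Holds, hφ, hblock, hall]
  constructor
  · rintro ⟨τ, hτ, h⟩
    exact ⟨τ, hτ.agreeOn fun x hx h => (Finset.mem_sdiff.1 h).2 hx, h⟩
  · rintro ⟨τ, hτ, hex, h⟩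
    have hag : VarValuation.AgreeOn ((V : Set Var) ∪ F.keyVars) τ
        (.override ((F.keyVars \ V : Finset Var) : Set Var) θ τ) := by
      intro x hx
      by_cases h : x ∈ F.keyVars \ V
      · exact (VarValuation.get_override_of_mem h).symm
      · rw [VarValuation.get_override_of_notMem h]
        refine (hτ x ?_).symm
        simp only [Finset.mem_sdiff, Set.mem_union, Finset.mem_coe] at h hx ⊢
        tauto
    have hk : ((VarValuation.override ((F.keyVars \ V : Finset Var) : Set Var) θ τ).ground
        F).KeyEqual (τ.ground F) :=
      VarValuation.keyEqual_ground_iff.2 (hag.mono Set.subset_union_right).symm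
    refine ⟨_, VarValuation.agreeOff_override _ θ τ, ?_, fun A hA hkA => ?_⟩
    · obtain ⟨A, hA, hkA⟩ := hex
      exact ⟨A, hA, hk.trans hkA⟩
    · obtain ⟨σ, hσ, h⟩ := h A hA (hk.symm.trans hkA)
      exact ⟨σ, hag.symm.trans hσ, h⟩

end Atom

/-- Certainty of a query with an acyclic attack graph is first-order expressible. -/
theorem CQ.exists_rewriting {S : Schema} (q : CQ S) (V : Finset Var) (hsjf : q.SelfJoinFree)
    (hacyclic : q.AcyclicRel V) :
    ∃ φ : Formula S, φ.WellFormed ∧ φ.freeVars ⊆ V ∧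
      ∀ db θ, φ.Holds db θ ↔ q.CertainRel V θ db := by
  induction hn : q.length using Nat.strong_induction_on generalizing q V with
  | _ n ih =>
  subst hn
  by_cases hq : q = []
  · subst hq
    refine ⟨.verum, trivial, by simp [Formula.freeVars], fun db θ => ?_⟩
    simp only [Formula.Holds, true_iff]
    exact fun r _ => ⟨θ, .refl _ _, by simp⟩
  obtain ⟨F, hF, hatt⟩ := hacyclic.exists_unattacked hq
  have hacyclic' := hacyclic.without F
  rw [← Finset.coe_union] at hacyclic'
  obtain ⟨φ, hwf, hfree, hφ⟩ := ih _ (CQ.length_without_lt hF) (q.without F) (V ∪ F.vars)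
    (hsjf.without F) hacyclic' rfl
  -- Variables bound inside `φ` need not be avoided, since its truth depends only on `V ∪ F.vars`.
  obtain ⟨N, hN⟩ := ((V ∪ F.vars).image Var.index).exists_nat_subset_range
  have hlt : ∀ x ∈ V ∪ F.vars, x.index < N := fun x hx =>
    Finset.mem_range.1 (hN (Finset.mem_image_of_mem _ hx))
  refine ⟨F.blockFormula N V φ, F.wellFormed_blockFormula N V hwf,
    F.freeVars_blockFormula_subset N V hfree, fun db θ => ?_⟩
  rw [CQ.certainRel_iff hsjf hF hatt, Atom.holds_blockFormula
    (fun x hx => hlt x (Finset.mem_union_left _ hx))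
    (fun x hx => hlt x (Finset.mem_union_right _ hx)) (P := fun θ => (q.without F).CertainRel (V ∪ F.vars) θ db)
    (fun θ τ h h' => CQ.CertainRel.congr h h')
    (fun θ => by rw [hφ, Finset.coe_union])]

/-! ## Aggregation queries over repairs -/

namespace CQ

variable {S : Schema}

theorem holds_body {q : CQ S} {db : Database S} {θ : VarValuation S} :
    q.body.Holds db θ ↔ ∀ F ∈ q, θ.ground F ∈ db := by
  induction q with
  | nil => simp [body, Formula.Holds]
  | cons F q ih => simp only [body, List.foldr_cons, Formula.Holds] at ih ⊢; simp [ih]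

theorem freeVars_body (q : CQ S) : q.body.freeVars = q.vars := by
  induction q with
  | nil => rfl
  | cons F q ih =>
    simp only [body, vars, List.foldr_cons, Formula.freeVars] at ih ⊢
    rw [ih]

theorem wellFormed_body (q : CQ S) : q.body.WellFormed := by
  induction q with
  | nil => trivial
  | cons F q ih => exact ⟨trivial, ih⟩

/-- The valuations of the variables of `q` (extended by `θ`) that map `q` into `db`. -/
def embeddings (q : CQ S) (db : Database S) (θ : VarValuation S) : Set (VarValuation S) :=
  {τ | θ.AgreeOff q.vars τ ∧ ∀ F ∈ q, τ.ground F ∈ db}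

/-- An embedding is determined by the facts to which it sends the atoms, and the instance is finite.
-/
theorem finite_embeddings (q : CQ S) (db : Database S) (θ : VarValuation S) :
    (q.embeddings db θ).Finite := by
  classical
  have : Finite {F // F ∈ q} := q.finite_toSet
  refine Finite.of_injective (β := {F // F ∈ q} → {A // A ∈ db})
    (fun (τ : q.embeddings db θ) F => ⟨τ.1.ground F, τ.2.2 F F.2⟩) fun τ σ h => ?_
  refine Subtype.ext (VarValuation.ext_get fun x => ?_)
  by_cases hx : x ∈ q.vars
  · obtain ⟨F, hF, hxF⟩ := mem_vars.1 hx
    have := congrFun h ⟨F, hF⟩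
    exact VarValuation.ground_eq_iff.1 (congrArg Subtype.val this) x hxF
  · rw [τ.2.1 x hx, σ.2.1 x hx]

theorem embeddings_mono (q : CQ S) {r db : Database S} (h : r ⊆ db) (θ : VarValuation S) :
    q.embeddings r θ ⊆ q.embeddings db θ :=
  fun _ hτ => ⟨hτ.1, fun F hF => h (hτ.2 F hF)⟩

theorem SatisfiedIn.nonempty_embeddings {q : CQ S} {db : Database S} (h : q.SatisfiedIn db)
    (θ : VarValuation S) : (q.embeddings db θ).Nonempty := by
  obtain ⟨τ, hτ⟩ := h
  refine ⟨.override (q.vars : Set Var) θ τ, VarValuation.agreeOff_override _ _ _, fun F hF => ?_⟩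
  rw [VarValuation.ground_eq_iff.2 fun x hx => VarValuation.get_override_of_mem
    (Finset.mem_coe.2 (mem_vars.2 ⟨F, hF, hx⟩))]
  exact hτ F hF

/-- The image of a self-join-free conjunction under a valuation is consistent. -/
theorem SelfJoinFree.exists_isRepair {q : CQ S} (hq : q.SelfJoinFree) {db : Database S}
    {θ : VarValuation S} (hθ : ∀ F ∈ q, θ.ground F ∈ db) :
    ∃ r, db.IsRepair r ∧ ∀ F ∈ q, θ.ground F ∈ r := by
  classical
  obtain ⟨r, hr, hsub⟩ := Database.exists_isRepair_superset (db := db)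
    (q.toFinset.image θ.ground) (fun A hA => by
      obtain ⟨F, hF, rfl⟩ := Finset.mem_image.1 hA
      exact hθ F (List.mem_toFinset.1 hF)) (fun A hA B hB hAB => by
      obtain ⟨F, hF, rfl⟩ := Finset.mem_image.1 hA
      obtain ⟨G, hG, rfl⟩ := Finset.mem_image.1 hB
      rw [hq.eq_of_rel_eq (List.mem_toFinset.1 hF) (List.mem_toFinset.1 hG) hAB.rel_eq])
  exact ⟨r, hr, fun F hF => hsub (Finset.mem_image_of_mem _ (List.mem_toFinset.2 hF))⟩

end CQ

theorem AggOp.exists_min_over {S : Schema} (f₀ : Option NNRat) {Θ : Set (VarValuation S)}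
    (hfin : Θ.Finite) (hne : Θ.Nonempty) (p : NumPrim) :
    ∃ v, (AggOp.min f₀).over Θ p = some v ∧
      IsLeast ((fun θ : VarValuation S => θ.primVal p) '' Θ) v := by
  classical
  obtain ⟨θ, hθ⟩ := hne
  have h0 : (hfin.toFinset.val.map fun θ => θ.primVal p) ≠ 0 := by
    intro h
    rw [Multiset.map_eq_zero, Finset.val_eq_zero] at h
    have : θ ∈ hfin.toFinset := by simpa using hθ
    simp [h] at this
  refine ⟨_, by rw [AggOp.over, dif_pos hfin, AggOp.apply, dif_neg h0], ?_⟩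
  have hset : ((hfin.toFinset.val.map fun θ => θ.primVal p).toFinset : Set NNRat) =
      (fun θ : VarValuation S => θ.primVal p) '' Θ := by
    ext x; simp
  rw [← hset]
  exact Finset.isLeast_min' _ (by simpa using h0)

theorem AggOp.over_empty {S : Schema} (F : AggOp) (p : NumPrim) :
    F.over (∅ : Set (VarValuation S)) p = F.onEmpty := by
  simp [AggOp.over, AggOp.apply]

namespace AggQuery

variable {S : Schema}

theorem value_toNumTerm (g : AggQuery S) (db : Database S) :
    g.toNumTerm.value db = g.op.over (g.body.embeddings db (VarValuation.zero S)) g.head := by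
  simp only [NumTerm.value, toNumTerm, NumTerm.eval, CQ.holds_body]
  rfl

/-- If the body is certain, then the least value over all repairs of a minimum query is the
minimum over the database instance itself. -/
theorem isGlbCQA_some (g : AggQuery S) {f₀ : Option NNRat} (hmin : g.op = AggOp.min f₀)
    {db : Database S} (hc : g.body.CertainIn db) {v : NNRat}
    (hv : IsLeast ((fun θ : VarValuation S => θ.primVal g.head) ''
      g.body.embeddings db (VarValuation.zero S)) v) : g.IsGlbCQA db (some v) := by
  have hrep : ∀ r, db.IsRepair r → ∃ u, g.toNumTerm.value r = some u ∧
      IsLeast ((fun θ : VarValuation S => θ.primVal g.head) ''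
        g.body.embeddings r (VarValuation.zero S)) u := by
    intro r hr
    rw [value_toNumTerm, hmin]
    exact AggOp.exists_min_over f₀ (g.body.finite_embeddings _ _)
      ((hc r hr).nonempty_embeddings _) _
  have hle : ∀ r, db.IsRepair r → ∀ u, IsLeast ((fun θ : VarValuation S => θ.primVal g.head) ''
      g.body.embeddings r (VarValuation.zero S)) u → v ≤ u := fun r hr u hu =>
    hv.2 (Set.image_mono (g.body.embeddings_mono hr.1.1 _) hu.1)
  refine ⟨hc, ?_, ?_⟩
  -- A minimizing valuation survives in some repair, which thus attains `v`.
  · obtain ⟨θ, hθ, hθv⟩ := hv.1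
    obtain ⟨r, hr, hrθ⟩ := g.selfJoinFree.exists_isRepair hθ.2
    obtain ⟨u, hu, hleast⟩ := hrep r hr
    refine ⟨r, hr, ?_⟩
    rw [hu, le_antisymm (hleast.2 ⟨θ, ⟨hθ.1, hrθ⟩, hθv⟩) (hle r hr u hleast)]
  · rintro u ⟨r, hr, hu⟩
    obtain ⟨u', hu', hleast⟩ := hrep r hr
    rw [hu'] at hu
    exact Option.some.inj hu ▸ hle r hr u' hleast

theorem isGlbCQA_none (g : AggQuery S) {db : Database S} (h : ¬ g.body.CertainIn db) :
    g.IsGlbCQA db none := by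
  change ∃ r, _
  simpa [CQ.CertainIn] using h

/-- The minimum over `db` of a query with certain body, whatever the convention for the empty
multiset. -/
theorem isGlbCQA_min_over (g : AggQuery S) {f₀ : Option NNRat} (hmin : g.op = AggOp.min f₀)
    (f₁ : Option NNRat) {db : Database S} (hc : g.body.CertainIn db) :
    g.IsGlbCQA db
      ((AggOp.min f₁).over (g.body.embeddings db (VarValuation.zero S)) g.head) := by
  obtain ⟨r, hr⟩ := db.exists_isRepair
  obtain ⟨v, hv, hleast⟩ := AggOp.exists_min_over f₁ (g.body.finite_embeddings db _)
    (((hc r hr).nonempty_embeddings (VarValuation.zero S)).mono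
      (g.body.embeddings_mono hr.1.1 _)) g.head
  rw [hv]
  exact g.isGlbCQA_some hmin hc hleast

theorem glbExpressible_of_min (g : AggQuery S) {f₀ : Option NNRat} (hmin : g.op = AggOp.min f₀)
    (hacyclic : g.body.AcyclicAttackGraph) : g.GlbExpressible := by
  obtain ⟨φ, hwf, hfree, hφ⟩ := g.body.exists_rewriting ∅ g.selfJoinFree
    (by simpa using hacyclic.acyclicRel)
  have hφ' : ∀ db θ, φ.Holds db θ ↔ g.body.CertainIn db := fun db θ => by
    rw [hφ, Finset.coe_empty, CQ.certainRel_empty]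
  have hfreeVars : (Formula.and g.body.body φ).freeVars = g.body.vars := by
    rw [Formula.freeVars, g.body.freeVars_body, Finset.subset_empty.1 hfree, Finset.union_empty]
  -- The closed conjunct `φ` keeps all embeddings if the body is certain and none otherwise; in the
  -- latter case the empty multiset must give `⊥`, hence `none` in place of `f₀`.
  refine ⟨.agg (AggOp.min none) g.body.vars g.head (.and g.body.body φ), ⟨?_, ?_⟩, fun db => ?_⟩
  · refine ⟨hfreeVars.ge, hfreeVars.ge.trans' g.head_vars, ⟨g.body.wellFormed_body, hwf⟩,
      fun db θ => (g.body.finite_embeddings db θ).subset fun τ hτ => ⟨hτ.1, ?_⟩⟩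
    exact CQ.holds_body.1 hτ.2.1
  · rw [NumTerm.freeVars, hfreeVars, Finset.sdiff_eq_empty_iff_subset]
    exact Finset.union_subset g.head_vars subset_rfl
  · simp only [NumTerm.value, NumTerm.eval, Formula.Holds, CQ.holds_body, hφ']
    by_cases hc : g.body.CertainIn db
    · simp only [hc, and_true]
      exact g.isGlbCQA_min_over hmin none hc
    · simp only [hc, and_false, Set.ofPred_false, AggOp.over_empty]
      exact g.isGlbCQA_none hc

end AggQuery

theorem mainTheorem5 (S : Schema) (g : AggQuery S) (f₀ : Option NNRat)
    (hmin : g.op = AggOp.min f₀) (hacyclic : g.body.AcyclicAttackGraph) :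
    g.GlbExpressible ∧
      ∀ db : Database S,
        (g.body.CertainIn db → g.IsGlbCQA db (g.toNumTerm.value db)) ∧
        (¬ g.body.CertainIn db → g.IsGlbCQA db none) := by
  refine ⟨g.glbExpressible_of_min hmin hacyclic, fun db => ⟨fun hc => ?_, g.isGlbCQA_none⟩⟩
  rw [g.value_toNumTerm, hmin]
  exact g.isGlbCQA_min_over hmin f₀ hc
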